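/- Let $h\ge 7$ and let $P=\mathbb F_2[t_1,\dots,t_h]$, graded by $\deg t_j=1$, with the usual action of the mod $2$ Steenrod algebra $\mathcal A$ (determined by the Cartan formula and $Sq^0t_j=t_j$, $Sq^1t_j=t_j^2$, $Sq^kt_j=0$ for $k>1$). Let $\overline{\mathcal A}$ be the set of elements of positive degree in $\mathcal A$. Let $P^0\subset P$ be the $\mathcal A$-submodule spanned by the monomials $t_1^{a_1}\cdots t_h^{a_h}$ with $a_1a_2\cdots a_h=0$. The weight vector of a monomial $t=t_1^{a_1}\cdots t_h^{a_h}$ is the sequence $\omega(t)=(\omega_1(t),\omega_2(t),\dots)$, where $\omega_i(t)=\sum_{j=1}^h\alpha_{i-1}(a_j)$ and $\alpha_{i-1}(a)$ is the coefficient of $2^{i-1}$ in the binary expansion of $a$. Weight vectors are ordered left lexicographically, and finite sequences are extended by zeros. For a weight vector $\omega$ with $\sum_{i\ge1}2^{i-1}\omega_i=n$, let $P^0_n(\omega)$ (respectively $P^0_n(<\omega)$) be the span of the monomials $t\in P^0$ of degree $n$ with $\omega(t)\le\omega$ (respectively $\omega(t)<\omega$), and put $$(QP^{\otimes h}_n)^0(\omega)=P^0_n(\omega)\Big/\Big(\big(\overline{\mathcal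 A}P^0\cap P^0_n(\omega)\big)+P^0_n(<\omega)\Big),$$ where $\overline{\mathcal A}P^0$ is the span of all $\theta f$ with $\theta\in\overline{\mathcal A}$ and $f\in P^0$. Let $\overline\omega^{(1)}=(2,2,1)$, $\overline\omega^{(2)}=(2,4)$, $\overline\omega^{(3)}=(4,1,1)$, $\overline\omega^{(4)}=(4,3)$, $\overline\omega^{(5)}=(6,2)$. Then $$\dim_{\mathbb F_2}(QP^{\otimes h}_{10})^0(\overline\omega^{(j)})=\begin{cases} 2\left[\binom h2+4\binom h3+6\binom h4\right]+5\binom h5 & \text{if } j=1,\\ 5\binom h5+4\binom h6 & \text{if } j=2,\\ 10\left[\binom h4+2\binom h5+\binom h6\right] & \text{if } j=3,\\ 812 & \text{if } j=4,\ h=7,\\ 4\left[\binom h4+5\binom h5+9\binom h6+5\binom h7\right] & \text{if } j=4,\ h\ge 8,\\ 105 & \text{if } j=5,\ h=7,\\ 700 & \text{if } j=5,\ h=8,\\ 5\left[3\binom h6+7\binom h7+4\binom h8\right] & \text{if } j=5,\ h\ge 9. \end{cases}$$ -/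

import Mathlib

open MvPolynomial

noncomputable section

namespace HitProblem

/-- The polynomial algebra `P = 𝔽₂[t₁, …, t_h]`, graded by the usual degree. -/
abbrev P (h : ℕ) : Type := MvPolynomial (Fin h) (ZMod 2)

/-- The total Steenrod square `f ↦ ∑ₖ Sqᵏ(f) Xᵏ`: it is the algebra homomorphism (Cartan formula)
with `tⱼ ↦ tⱼ + tⱼ² X`, that is, `Sq⁰ tⱼ = tⱼ`, `Sq¹ tⱼ = tⱼ²` and `Sqᵏ tⱼ = 0` for `k > 1`. -/
def totalSq (h : ℕ) : P h →ₐ[ZMod 2] Polynomial (P h) :=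
  aeval fun j => Polynomial.C (X j) + Polynomial.C (X j ^ 2) * Polynomial.X

/-- The Steenrod square `Sqᵏ`, as an `𝔽₂`-linear endomorphism of `P`. -/
def Sq (h k : ℕ) : Module.End (ZMod 2) (P h) :=
  ((Polynomial.lcoeff (P h) k).restrictScalars (ZMod 2)).comp (totalSq h).toLinearMap

/-- The operations on `P` given by the elements of positive degree of the Steenrod algebra. Since
the Steenrod algebra is generated by the squares, these are the linear combinations of
compositions of one or more squares `Sqᵏ` with `k ≥ 1`. -/
def positiveSteenrod (h : ℕ) : NonUnitalSubalgebra (ZMod 2) (Module.End (ZMod 2) (P h)) :=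
  NonUnitalAlgebra.adjoin (ZMod 2) {θ | ∃ k : ℕ, 1 ≤ k ∧ θ = Sq h k}

/-- The hit elements of `M`: the span of all `θ f` with `f ∈ M` and `θ` a Steenrod operation of
positive degree. -/
def hits {h : ℕ} (M : Submodule (ZMod 2) (P h)) : Submodule (ZMod 2) (P h) :=
  Submodule.span (ZMod 2) {g | ∃ θ ∈ positiveSteenrod h, ∃ f ∈ M, g = θ f}

/-- The weight vector of the monomial with exponents `a`. The entry with index `i` (counted from
`0`) is the sum over `j` of the `i`-th binary digits of `a j`. Weight vectors are sequences of
natural numbers with the left lexicographical order. -/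
def weightVector {h : ℕ} (a : Fin h →₀ ℕ) : Lex (ℕ → ℕ) :=
  toLex fun i => ∑ j : Fin h, a j / 2 ^ i % 2

/-- The finite sequence `l`, extended by zeros. -/
def ofList (l : List ℕ) : Lex (ℕ → ℕ) :=
  toLex fun i => l.getD i 0

/-- The span of the monomials of degree `n` and weight vector at most `ω`. -/
def weightLE (h n : ℕ) (ω : Lex (ℕ → ℕ)) : Submodule (ZMod 2) (P h) :=
  restrictSupport (ZMod 2) {a | ∑ j, a j = n ∧ weightVector a ≤ ω}

/-- The span of the monomials of degree `n` and weight vector less than `ω`. -/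
def weightLT (h n : ℕ) (ω : Lex (ℕ → ℕ)) : Submodule (ZMod 2) (P h) :=
  restrictSupport (ZMod 2) {a | ∑ j, a j = n ∧ weightVector a < ω}

/-- `P⁰`, the span of the monomials in which at least one of the variables does not occur. -/
def PZero (h : ℕ) : Submodule (ZMod 2) (P h) :=
  restrictSupport (ZMod 2) {a | ∏ j, a j = 0}

/-- The elements of `M_n(ω)` that are `ω`-hit in `M`: the sums of a hit element of `M` lying in
`M_n(ω)` and an element of `M_n(<ω)`. -/
def omegaHits {h : ℕ} (M : Submodule (ZMod 2) (P h)) (n : ℕ) (ω : Lex (ℕ → ℕ)) :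
    Submodule (ZMod 2) (P h) :=
  (hits M ⊓ (M ⊓ weightLE h n ω)) ⊔ (M ⊓ weightLT h n ω)

/-- `(QP_n)⁰(ω)`, the quotient of `(P⁰)_n(ω)` by its `ω`-hit elements; here `n` is the degree of
the weight vector `ω`. -/
abbrev QPZero (h n : ℕ) (ω : Lex (ℕ → ℕ)) : Type :=
  ↥(PZero h ⊓ weightLE h n ω) ⧸
    (omegaHits (PZero h) n ω).comap (PZero h ⊓ weightLE h n ω).subtype

end HitProblem

end

noncomputable section

namespace HitProblem

/-! ### Lists of exponents -/

/-! Since `Sq^k` sends `t^x` to `(x choose k) t^(x+k)`, squares neither introduce nor remove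
variables. Hence `P` is the direct sum, over subsets `S` of the variables, of the stable subspaces
spanned by the monomials with support exactly `S`, and `P⁰` is the sum of those with `S` proper. Up
to relabelling a summand depends only on `s = |S|`, so the dimension is the sum over `s < h` of
`h.choose s` times a number `d_s(ω)` independent of `h`; it vanishes for `s > 10` in degree ten. The
separate small cases of `h` arise because `s = h` is excluded.

The `d_s(ω)` come from Gaussian elimination. The monomials are listed by increasing weight vector
and the hit vectors are eliminated at their highest monomial, so a normal form involves no larger
weights. The monomials of weight `ω` that equal their own normal form give a basis of the quotient.
They span, because a monomial differs from its normal form by a hit element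
(`monomial_add_expand_mem_hits`). They are independent, because the coefficients of the normal form
kill hit elements (`normalCoeff_of_mem_hits`) and lower weights. `finrank_QPZero` combines the two.

No general theory of echelon forms is needed: the computation `checkNormalForms_eq_true` verifies
that hit vectors reduce to zero and that normal forms consist of fixed monomials of no larger
weight. -/

/-- The compositions of `n` into `s` positive parts. -/
def compositions : ℕ → ℕ → List (List ℕ)
  | n, 0 => if n = 0 then [[]] else []
  | n, s + 1 => (List.range n).flatMap fun i => (compositions (n - 1 - i) s).map ((i + 1) :: ·)

/-- The exponents of the monomials in `Sqᵏ` of the monomial with exponents `l`. -/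
def sqTerms : ℕ → List ℕ → List (List ℕ)
  | k, [] => if k = 0 then [[]] else []
  | k, x :: l => (List.range (k + 1)).flatMap fun i =>
      if x.choose i % 2 = 1 then (sqTerms (k - i) l).map ((x + i) :: ·) else []

/-- The entry with index `i` of the weight vector of the monomial with exponents `l`. -/
def listWeight (l : List ℕ) (i : ℕ) : ℕ := (l.map fun x => x / 2 ^ i % 2).sum

/-- The first four entries of a sequence, as digits in base `100`. -/
def weightCode (w : ℕ → ℕ) : ℕ := ((w 0 * 100 + w 1) * 100 + w 2) * 100 + w 3

/-- The codes of the weight vectors of degree ten, in increasing order. -/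
def weightCodes : List ℕ :=
  [10001, 10200, 30100, 50000, 2000001, 2000200, 2020100, 2040000, 4010100, 4030000, 6000100,
    6020000, 8010000, 10000000]

/-- The compositions of ten into `s` parts, with increasing weight vectors. -/
def sortedCompositions (s : ℕ) : List (List ℕ) :=
  weightCodes.flatMap fun w => (compositions 10 s).filter fun l => weightCode (listWeight l) = w

theorem mem_compositions {n s : ℕ} {l : List ℕ} :
    l ∈ compositions n s ↔ l.length = s ∧ (∀ x ∈ l, 0 < x) ∧ l.sum = n := by
  induction s generalizing n l with
  | zero =>
    rw [compositions]
    split_ifs with hn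
    · cases l <;> simp [hn]
    · cases l <;> simp; omega
  | succ s ih =>
    rw [compositions]
    cases l with
    | nil => simp
    | cons y l =>
      simp only [List.mem_flatMap, List.mem_range, List.mem_map, ih, List.cons.injEq,
        List.length_cons, List.mem_cons, forall_eq_or_imp, List.sum_cons, add_left_inj]
      constructor
      · rintro ⟨i, hi, m, ⟨h1, h2, h3⟩, rfl, rfl⟩
        exact ⟨h1, ⟨by omega, h2⟩, by omega⟩
      · rintro ⟨h1, ⟨h2, h3⟩, h4⟩
        exact ⟨y - 1, by omega, l, ⟨h1, h3, by omega⟩, by omega, rfl⟩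

/-- Exponents only grow, so a square preserves the support of a monomial; this underlies the
splitting over subsets of the variables. -/
theorem mem_sqTerms {k : ℕ} {l t : List ℕ} (ht : t ∈ sqTerms k l) :
    t.length = l.length ∧ ((∀ x ∈ l, 0 < x) → ∀ x ∈ t, 0 < x) ∧ t.sum = l.sum + k := by
  induction l generalizing k t with
  | nil =>
    rw [sqTerms] at ht
    split_ifs at ht with hk
    · simp_all
    · simp at ht
  | cons y l ih =>
    simp only [sqTerms, List.mem_flatMap, List.mem_range] at ht
    obtain ⟨i, hi, ht⟩ := ht
    split_ifs at ht with hc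
    · obtain ⟨m, hm, rfl⟩ := List.mem_map.1 ht
      obtain ⟨h1, h2, h3⟩ := ih hm
      refine ⟨by simp [h1], fun h x hx => ?_, by simp [h3]; omega⟩
      simp only [List.mem_cons, forall_eq_or_imp] at h hx
      rcases hx with rfl | hx
      · omega
      · exact h2 h.2 x hx
    · simp at ht

theorem length_le_sum_of_pos {l : List ℕ} (hl : ∀ x ∈ l, 0 < x) : l.length ≤ l.sum := by
  induction l with
  | nil => simp
  | cons y l ih =>
    simp only [List.mem_cons, forall_eq_or_imp] at hl
    have := ih hl.2
    simp only [List.length_cons, List.sum_cons]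
    omega

theorem compositions_eq_nil {n s : ℕ} (h : n < s) : compositions n s = [] := by
  rw [List.eq_nil_iff_forall_not_mem]
  intro l hl
  obtain ⟨h1, h2, h3⟩ := mem_compositions.1 hl
  have := length_le_sum_of_pos h2
  omega

theorem mem_compositions_of_mem_sorted {s : ℕ} {l : List ℕ} (hl : l ∈ sortedCompositions s) :
    l ∈ compositions 10 s := by
  simp only [sortedCompositions, List.mem_flatMap, List.mem_filter] at hl
  obtain ⟨w, -, hl, -⟩ := hl
  exact hl

/-! ### Bit vectors and elimination over the field with two elements -/

/-- The bit of `x` with index `i`, as an element of the field with two elements. -/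
def bit (x i : ℕ) : ZMod 2 := if x.testBit i then 1 else 0

theorem bit_zero (i : ℕ) : bit 0 i = 0 := by simp [bit]

theorem bit_xor (x y i : ℕ) : bit (x ^^^ y) i = bit x i + bit y i := by
  simp only [bit, Nat.testBit_xor]
  cases x.testBit i <;> cases y.testBit i <;> simp
  decide

theorem bit_two_pow (i j : ℕ) : bit (2 ^ i) j = if i = j then 1 else 0 := by
  simp [bit, Nat.testBit_two_pow]

/-- The bit vector with a single one, at the first position of `t` in the list, if there is one. -/
def mask : List (List ℕ) → List ℕ → ℕ
  | [], _ => 0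
  | m :: M, t => if m = t then 1 else 2 * mask M t

/-- The sum of the bit vectors of the members of `T`. -/
def sumMask (M T : List (List ℕ)) : ℕ := T.foldr (fun t x => mask M t ^^^ x) 0

/-- The result of clearing the leading bits of the members of `B` in `x`. -/
def reduce : List ℕ → ℕ → ℕ
  | [], x => x
  | v :: B, x => if (reduce B x).testBit v.log2 then reduce B x ^^^ v else reduce B x

/-- Gaussian elimination: an echelon basis of the span of the bit vectors in the list. -/
def echelon : List ℕ → List ℕ
  | [] => []
  | g :: G => if reduce (echelon G) g = 0 then echelon G else reduce (echelon G) g :: echelon G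

theorem mask_eq_zero {M : List (List ℕ)} {t : List ℕ} (ht : t ∉ M) : mask M t = 0 := by
  induction M with
  | nil => rfl
  | cons m M ih =>
    simp only [List.mem_cons, not_or] at ht
    rw [mask, if_neg (Ne.symm ht.1), ih ht.2]

theorem exists_mask_eq {M : List (List ℕ)} {t : List ℕ} (ht : t ∈ M) :
    ∃ j < M.length, mask M t = 2 ^ j ∧ M.getD j [] = t := by
  induction M with
  | nil => simp at ht
  | cons m M ih =>
    by_cases h : m = t
    · exact ⟨0, by simp, by simp [mask, h], by simp [h]⟩
    · obtain ⟨j, hj, h1, h2⟩ := ih ((List.mem_cons.1 ht).resolve_left (Ne.symm h))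
      exact ⟨j + 1, by simpa using hj, by rw [mask, if_neg h, h1, pow_succ, mul_comm],
        by simpa using h2⟩

theorem sumMask_eq_zero {M T : List (List ℕ)} (h : ∀ t ∈ T, t ∉ M) : sumMask M T = 0 := by
  induction T with
  | nil => rfl
  | cons t T ih =>
    simp only [List.mem_cons, forall_eq_or_imp] at h
    have h2 := ih h.2
    rw [sumMask] at h2 ⊢
    rw [List.foldr_cons, h2, mask_eq_zero h.1]
    rfl

/-- Clearing the bit `p` with `v` is the map `x ↦ x + x_p v`, which is linear over the field with
two elements; no echelon property of `B` is used. -/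
theorem reduce_xor (B : List ℕ) (x y : ℕ) : reduce B (x ^^^ y) = reduce B x ^^^ reduce B y := by
  induction B with
  | nil => rfl
  | cons v B ih =>
    simp only [reduce, ih, Nat.testBit_xor]
    cases (reduce B x).testBit v.log2 <;> cases (reduce B y).testBit v.log2 <;> simp
    · rw [Nat.xor_assoc]
    · rw [Nat.xor_right_comm]
    · rw [Nat.xor_right_comm, ← Nat.xor_assoc, Nat.xor_assoc _ v v, Nat.xor_self, Nat.xor_zero]

theorem reduce_zero (B : List ℕ) : reduce B 0 = 0 := by
  have := reduce_xor B 0 0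
  rwa [Nat.xor_self, Nat.xor_self] at this

theorem bit_reduce_sumMask (B : List ℕ) (M T : List (List ℕ)) (i : ℕ) :
    bit (reduce B (sumMask M T)) i = (T.map fun t => bit (reduce B (mask M t)) i).sum := by
  induction T with
  | nil => simp [sumMask, reduce_zero, bit_zero]
  | cons t T ih =>
    rw [sumMask] at ih ⊢
    rw [List.foldr_cons, reduce_xor, bit_xor, ih, List.map_cons, List.sum_cons]

/-- Reduction changes `x` only by members of `B`. Here `W` stands for a subspace; it is later taken
to be the condition that the expanded polynomial is hit. -/
theorem reduce_xor_self_mem {W : ℕ → Prop} (h0 : W 0) (hW : ∀ x y, W x → W y → W (x ^^^ y))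
    {B : List ℕ} (hB : ∀ v ∈ B, W v) (x : ℕ) : W (x ^^^ reduce B x) := by
  induction B with
  | nil => simpa [reduce] using h0
  | cons v B ih =>
    simp only [List.mem_cons, forall_eq_or_imp] at hB
    rw [reduce]
    split_ifs
    · rw [← Nat.xor_assoc]
      exact hW _ _ (ih hB.2) hB.1
    · exact ih hB.2

theorem echelon_mem {W : ℕ → Prop} (h0 : W 0) (hW : ∀ x y, W x → W y → W (x ^^^ y))
    {G : List ℕ} (hG : ∀ g ∈ G, W g) : ∀ v ∈ echelon G, W v := by
  induction G with
  | nil => simp [echelon]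
  | cons g G ih =>
    simp only [List.mem_cons, forall_eq_or_imp] at hG
    have h1 := ih hG.2
    rw [echelon]
    split_ifs
    · exact h1
    · simp only [List.mem_cons, forall_eq_or_imp]
      refine ⟨?_, h1⟩
      have := hW _ _ hG.1 (reduce_xor_self_mem h0 hW h1 g)
      rwa [← Nat.xor_assoc, Nat.xor_self, Nat.zero_xor] at this

/-! ### The hit elements of degree ten in few variables -/

/-- The bit vectors of the squares of the monomials in exactly `s` variables, in degree ten. -/
def hitMasks (M : List (List ℕ)) (s : ℕ) : List ℕ :=
  (List.range 10).flatMap fun k => (compositions (9 - k) s).map fun l =>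
    sumMask M (sqTerms (k + 1) l)

/-- The normal form, modulo the hit elements, of the monomial with exponents `l`. -/
def normalForm (s : ℕ) (l : List ℕ) : ℕ :=
  reduce (echelon (hitMasks (sortedCompositions s) s)) (mask (sortedCompositions s) l)

/-- The indices of the monomials of the weight vector with code `w` that are in normal form. -/
def normalIndices (s w : ℕ) : Finset ℕ :=
  (Finset.range (sortedCompositions s).length).filter fun j =>
    weightCode (listWeight ((sortedCompositions s).getD j [])) = w ∧
      normalForm s ((sortedCompositions s).getD j []) = 2 ^ j

/-- The numbers of monomials in exactly `s` variables that are in normal form, for the weight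
vectors `(2, 2, 1)`, `(2, 4)`, `(4, 1, 1)`, `(4, 3)` and `(6, 2)`. -/
def normalCounts (s : ℕ) : List ℕ :=
  match s with
  | 2 => [2, 0, 0, 0, 0]
  | 3 => [8, 0, 0, 0, 0]
  | 4 => [12, 0, 10, 4, 0]
  | 5 => [5, 5, 20, 20, 0]
  | 6 => [0, 4, 10, 36, 15]
  | 7 => [0, 0, 0, 20, 35]
  | 8 => [0, 0, 0, 0, 20]
  | _ => [0, 0, 0, 0, 0]

/-! ### Verified elimination in degree ten -/

/-- Evaluation of a natural number before it is passed on. -/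
def eager {α : Type} : ℕ → (ℕ → α) → α
  | 0, f => f 0
  | n + 1, f => f (n + 1)

/-- Evaluation of the members of a list before it is passed on. -/
def eagerList {α β : Type} (g : β → (β → α) → α) : List β → (List β → α) → α
  | [], f => f []
  | x :: l, f => g x fun y => eagerList g l fun m => f (y :: m)

theorem eager_eq {α : Type} (n : ℕ) (f : ℕ → α) : eager n f = f n := by
  cases n <;> rfl

theorem eagerList_eq {α β : Type} {g : β → (β → α) → α} (hg : ∀ x f, g x f = f x) (l : List β)
    (f : List β → α) : eagerList g l f = f l := by
  induction l generalizing f with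
  | nil => rfl
  | cons x l ih => rw [eagerList, hg, ih]

/-- The verification that the normal forms vanish on hit elements and are combinations of
monomials in normal form whose weight vectors are not larger, with the given numbers of these. -/
def checkNormalForms (s : ℕ) : Bool :=
  eagerList (eagerList eager) (sortedCompositions s) fun M =>
  eagerList eager (hitMasks M s) fun H =>
  eagerList eager (echelon H) fun B =>
  eagerList eager (M.map fun m => reduce B (mask M m)) fun N =>
  eagerList eager (M.map fun m => weightCode (listWeight m)) fun W =>
  (compositions 10 s).all (fun l => weightCodes.contains (weightCode (listWeight l))) &&
  H.all (fun x => reduce B x == 0) &&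
  ((List.range M.length).all fun i => (List.range M.length).all fun j =>
    !(N.getD i 0).testBit j || (decide (W.getD j 0 ≤ W.getD i 0) && N.getD j 0 == 2 ^ j)) &&
  [2020100, 2040000, 4010100, 4030000, 6020000].map (fun w =>
    ((List.range M.length).filter fun j => W.getD j 0 == w && N.getD j 0 == 2 ^ j).length) ==
      normalCounts s

-- The bound 11 suffices: ten has no composition into more than ten positive parts.
set_option maxRecDepth 100000 in
theorem checkNormalForms_eq_true : ∀ s < 11, checkNormalForms s = true := by
  decide +kernel

theorem getD_map_of_lt {β γ : Type} (f : β → γ) {M : List β} {j : ℕ} (hj : j < M.length) (a : β)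
    (b : γ) : (M.map f).getD j b = f (M.getD j a) := by
  rw [List.getD_eq_getElem _ _ (by simpa using hj), List.getD_eq_getElem _ _ hj, List.getElem_map]

theorem checkNormalForms_spec {s : ℕ} (hs : s < 11) :
    (∀ l ∈ compositions 10 s, weightCode (listWeight l) ∈ weightCodes) ∧
    (∀ x ∈ hitMasks (sortedCompositions s) s,
      reduce (echelon (hitMasks (sortedCompositions s) s)) x = 0) ∧
    (∀ i < (sortedCompositions s).length, ∀ j < (sortedCompositions s).length,
      (normalForm s ((sortedCompositions s).getD i [])).testBit j = true →
      weightCode (listWeight ((sortedCompositions s).getD j [])) ≤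
        weightCode (listWeight ((sortedCompositions s).getD i [])) ∧
      normalForm s ((sortedCompositions s).getD j []) = 2 ^ j) ∧
    [2020100, 2040000, 4010100, 4030000, 6020000].map (fun w => (normalIndices s w).card) =
      normalCounts s := by
  have h := checkNormalForms_eq_true s hs
  have e : ∀ (l : List ℕ) (f : List ℕ → Bool), eagerList eager l f = f l := eagerList_eq eager_eq
  rw [checkNormalForms, eagerList_eq e] at h
  simp only [e, Bool.and_eq_true, List.all_eq_true, List.contains_iff_mem, beq_iff_eq] at h
  obtain ⟨⟨⟨h1, h2⟩, h3⟩, h4⟩ := h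
  refine ⟨h1, h2, fun i hi j hj hij => ?_, ?_⟩
  · have := h3 i (List.mem_range.2 hi) j (List.mem_range.2 hj)
    rw [getD_map_of_lt _ hi [], getD_map_of_lt _ hj [], getD_map_of_lt _ hi [],
      getD_map_of_lt _ hj []] at this
    rw [normalForm] at hij
    rw [hij] at this
    simpa [normalForm] using this
  · rw [← h4]
    refine List.map_congr_left fun w _ => ?_
    rw [normalIndices, Finset.card_def, Finset.filter_val, Finset.range_val, Multiset.range,
      Multiset.filter_coe, Multiset.coe_card]
    congr 1
    refine List.filter_congr fun j hj => ?_
    have hj := List.mem_range.1 hj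
    rw [getD_map_of_lt _ hj [], getD_map_of_lt _ hj [], Bool.eq_iff_iff]
    simp [normalForm]

theorem mem_sortedCompositions {s : ℕ} {l : List ℕ} :
    l ∈ sortedCompositions s ↔ l ∈ compositions 10 s := by
  refine ⟨mem_compositions_of_mem_sorted, fun hl => ?_⟩
  rcases lt_or_ge s 11 with hs | hs
  · simp only [sortedCompositions, List.mem_flatMap, List.mem_filter, decide_eq_true_eq]
    exact ⟨_, (checkNormalForms_spec hs).1 l hl, hl, rfl⟩
  · rw [compositions_eq_nil (by omega)] at hl
    simp at hl

theorem sortedCompositions_eq_nil {s : ℕ} (hs : 10 < s) : sortedCompositions s = [] := by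
  rw [List.eq_nil_iff_forall_not_mem]
  intro l hl
  rw [mem_sortedCompositions, compositions_eq_nil hs] at hl
  simp at hl

theorem card_normalIndices (s : ℕ) :
    [2020100, 2040000, 4010100, 4030000, 6020000].map (fun w => (normalIndices s w).card) =
      normalCounts s := by
  rcases lt_or_ge s 11 with hs | hs
  · exact (checkNormalForms_spec hs).2.2.2
  · have : ∀ w, normalIndices s w = ∅ := fun w => by
      rw [normalIndices, sortedCompositions_eq_nil hs]
      simp
    obtain ⟨s, rfl⟩ := Nat.exists_eq_add_of_le' hs
    simp [this, normalCounts]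

theorem normalForm_testBit {s : ℕ} {l : List ℕ} (hl : l ∈ sortedCompositions s) {j : ℕ}
    (hj : j < (sortedCompositions s).length) (h : (normalForm s l).testBit j = true) :
    weightCode (listWeight ((sortedCompositions s).getD j [])) ≤ weightCode (listWeight l) ∧
      normalForm s ((sortedCompositions s).getD j []) = 2 ^ j := by
  rcases lt_or_ge s 11 with hs | hs
  · obtain ⟨i, hi, -, rfl⟩ := exists_mask_eq hl
    exact (checkNormalForms_spec hs).2.2.1 i hi j hj h
  · simp [sortedCompositions_eq_nil hs] at hl

/-- The normal form of a hit element is zero. -/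
theorem sum_bit_normalForm_sqTerms {k : ℕ} (hk : 1 ≤ k) {l : List ℕ} (hl : ∀ x ∈ l, 0 < x)
    (i : ℕ) : ((sqTerms k l).map fun t => bit (normalForm l.length t) i).sum = 0 := by
  have key := bit_reduce_sumMask (echelon (hitMasks (sortedCompositions l.length) l.length))
    (sortedCompositions l.length) (sqTerms k l) i
  simp only [normalForm]
  rw [← key]
  by_cases hn : l.sum + k = 10
  · have hs := length_le_sum_of_pos hl
    rw [(checkNormalForms_spec (by omega)).2.1, bit_zero]
    simp only [hitMasks, List.mem_flatMap, List.mem_range, List.mem_map]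
    exact ⟨k - 1, by omega, l, mem_compositions.2 ⟨rfl, hl, by omega⟩, by
      rw [Nat.sub_add_cancel hk]⟩
  -- Outside degree ten no term of the square is listed, so every mask is zero.
  · rw [sumMask_eq_zero, reduce_zero, bit_zero]
    intro t ht htM
    have h1 := (mem_sqTerms ht).2.2
    have h2 := (mem_compositions.1 (mem_compositions_of_mem_sorted htM)).2.2
    omega

/-! ### Steenrod squares of monomials -/

variable {h : ℕ}

theorem Sq_apply (k : ℕ) (f : P h) : Sq h k f = (totalSq h f).coeff k := rfl

theorem Sq_mul (k : ℕ) (f g : P h) :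
    Sq h k (f * g) = ∑ i ∈ Finset.range (k + 1), Sq h i f * Sq h (k - i) g := by
  simp only [Sq_apply, map_mul, Polynomial.coeff_mul]
  rw [Finset.Nat.sum_antidiagonal_eq_sum_range_succ
    (fun i j => (totalSq h f).coeff i * (totalSq h g).coeff j)]

theorem Sq_one (k : ℕ) : Sq h k (1 : P h) = if k = 0 then 1 else 0 := by
  rw [Sq_apply, map_one, Polynomial.coeff_one]

/-- The total square of `t^x` is `(t + t²X)^x = t^x (1 + tX)^x`. -/
theorem Sq_X_pow (k x : ℕ) (v : Fin h) :
    Sq h k (X v ^ x : P h) = (x.choose k : P h) * X v ^ (x + k) := by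
  have e : (Polynomial.C (X v) + Polynomial.C (X v ^ 2) * Polynomial.X : Polynomial (P h)) =
      Polynomial.C (X v) * (1 + Polynomial.C (X v) * Polynomial.X) := by
    rw [pow_two, Polynomial.C_mul]
    ring
  have e2 : ((1 + Polynomial.C (X v) * Polynomial.X) ^ x : Polynomial (P h)) =
      ((1 + Polynomial.X) ^ x : Polynomial (P h)).comp (Polynomial.C (X v) * Polynomial.X) := by
    simp
  rw [Sq_apply, totalSq, map_pow, aeval_X, e, mul_pow, ← Polynomial.C_pow,
    Polynomial.coeff_C_mul, e2, Polynomial.comp_C_mul_X_coeff, Polynomial.coeff_one_add_X_pow]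
  ring

/-- The exponents that the list `l` gives to the variables in the list `vs`. -/
def exponents : List (Fin h) → List ℕ → (Fin h →₀ ℕ)
  | v :: vs, x :: l => Finsupp.single v x + exponents vs l
  | _, _ => 0

/-- The recursion of `sqTerms` is the Cartan formula with one variable split off, keeping only the
odd binomial coefficients. -/
theorem Sq_exponents (k : ℕ) {vs : List (Fin h)} {l : List ℕ} (hl : vs.length = l.length) :
    Sq h k (monomial (exponents vs l) 1) =
      ((sqTerms k l).map fun t => monomial (exponents vs t) (1 : ZMod 2)).sum := by
  induction vs generalizing k l with
  | nil =>
    obtain rfl : l = [] := List.length_eq_zero_iff.1 hl.symm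
    have : (monomial 0 1 : P h) = 1 := rfl
    rw [exponents, sqTerms, this, Sq_one]
    split_ifs <;> simp [exponents]
    simp
  | cons v vs ih =>
    cases l with
    | nil => simp at hl
    | cons x l =>
      have hl' : vs.length = l.length := by simpa using hl
      have hX : ∀ (y : ℕ) (e : Fin h →₀ ℕ),
          (monomial (Finsupp.single v y + e) 1 : P h) = X v ^ y * monomial e 1 := fun y e => by
        rw [X_pow_eq_monomial, monomial_mul, one_mul]
      rw [exponents, hX, Sq_mul, sqTerms, List.map_flatMap, List.flatMap_def, List.sum_flatten, List.map_map,
        Finset.sum, Finset.range_val, Multiset.range, Multiset.map_coe, Multiset.sum_coe]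
      congr 1
      refine List.map_congr_left fun i _ => ?_
      rw [Sq_X_pow, ih _ hl']
      have hc : (x.choose i : P h) = if x.choose i % 2 = 1 then 1 else 0 := by
        split_ifs with hc
        · obtain ⟨m, hm⟩ := Nat.odd_iff.2 hc
          have h2 : (2 : P h) = 0 := CharTwo.two_eq_zero
          rw [hm, Nat.cast_add, Nat.cast_mul, Nat.cast_two, h2, zero_mul, zero_add, Nat.cast_one]
        · exact (CharP.cast_eq_zero_iff (P h) 2 _).2 (by omega)
      rw [hc, Function.comp_apply]
      split_ifs
      · simp only [one_mul, List.map_map, Function.comp_def, exponents, hX, List.sum_map_mul_left]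
      · simp

theorem exponents_apply_of_notMem {vs : List (Fin h)} {v : Fin h} (hv : v ∉ vs) (l : List ℕ) :
    exponents vs l v = 0 := by
  induction vs generalizing l with
  | nil => rfl
  | cons w vs ih =>
    simp only [List.mem_cons, not_or] at hv
    cases l with
    | nil => rfl
    | cons x l => simp [exponents, ih hv.2, Finsupp.single_eq_of_ne hv.1]

theorem map_exponents {vs : List (Fin h)} (hvs : vs.Nodup) {l : List ℕ}
    (hl : vs.length = l.length) : vs.map (exponents vs l) = l := by
  induction vs generalizing l with
  | nil => simpa using hl.symm
  | cons v vs ih =>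
    cases l with
    | nil => simp at hl
    | cons x l =>
      rw [List.nodup_cons] at hvs
      have := ih hvs.2 (l := l) (by simpa using hl)
      simp only [exponents, List.map_cons, Finsupp.add_apply, Finsupp.single_eq_same,
        exponents_apply_of_notMem hvs.1, add_zero, List.cons.injEq, true_and]
      conv_rhs => rw [← this]
      refine List.map_congr_left fun w hw => ?_
      have : w ≠ v := fun e => hvs.1 (e ▸ hw)
      rw [Finsupp.add_apply, Finsupp.single_eq_of_ne this, zero_add]

theorem support_exponents {vs : List (Fin h)} (hvs : vs.Nodup) {l : List ℕ}
    (hl : vs.length = l.length) (hpos : ∀ x ∈ l, 0 < x) :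
    (exponents vs l).support = vs.toFinset := by
  ext v
  rw [Finsupp.mem_support_iff, List.mem_toFinset]
  refine ⟨fun hv => by_contra fun hn => hv (exponents_apply_of_notMem hn l), fun hv => ?_⟩
  have := List.mem_map_of_mem (f := exponents vs l) hv
  rw [map_exponents hvs hl] at this
  exact (hpos _ this).ne'

/-- The list of the nonzero exponents. -/
def nonzeroExponents (a : Fin h →₀ ℕ) : List ℕ := a.support.toList.map a

theorem length_nonzeroExponents (a : Fin h →₀ ℕ) :
    (nonzeroExponents a).length = a.support.card := by
  simp [nonzeroExponents]

theorem pos_of_mem_nonzeroExponents {a : Fin h →₀ ℕ} : ∀ x ∈ nonzeroExponents a, 0 < x := by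
  intro x hx
  obtain ⟨v, hv, rfl⟩ := List.mem_map.1 hx
  exact Nat.pos_of_ne_zero (Finsupp.mem_support_iff.1 (Finset.mem_toList.1 hv))

theorem nonzeroExponents_map_sum (a : Fin h →₀ ℕ) {f : ℕ → ℕ} (hf : f 0 = 0) :
    ((nonzeroExponents a).map f).sum = ∑ j, f (a j) := by
  rw [nonzeroExponents, List.map_map, Finset.sum_map_toList]
  refine Finset.sum_subset (Finset.subset_univ _) fun j _ hj => ?_
  rw [Function.comp_apply, Finsupp.notMem_support_iff.1 hj, hf]

theorem listWeight_nonzeroExponents (a : Fin h →₀ ℕ) (i : ℕ) :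
    listWeight (nonzeroExponents a) i = ofLex (weightVector a) i :=
  nonzeroExponents_map_sum a (by simp)

theorem nonzeroExponents_mem_sortedCompositions {a : Fin h →₀ ℕ} :
    nonzeroExponents a ∈ sortedCompositions a.support.card ↔ ∑ j, a j = 10 := by
  have := nonzeroExponents_map_sum a (f := id) rfl
  rw [List.map_id] at this
  rw [mem_sortedCompositions, mem_compositions, this]
  exact ⟨fun h => h.2.2, fun h => ⟨length_nonzeroExponents a, pos_of_mem_nonzeroExponents, h⟩⟩

/-- The exponents on the variables in `S` that are given by the list `l`. -/
def exponentsOn (S : Finset (Fin h)) (l : List ℕ) : Fin h →₀ ℕ := exponents S.toList l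

theorem support_exponentsOn {S : Finset (Fin h)} {l : List ℕ} (hl : l.length = S.card)
    (hpos : ∀ x ∈ l, 0 < x) : (exponentsOn S l).support = S := by
  rw [exponentsOn, support_exponents S.nodup_toList (by simp [hl]) hpos, Finset.toList_toFinset]

theorem nonzeroExponents_exponentsOn {S : Finset (Fin h)} {l : List ℕ} (hl : l.length = S.card)
    (hpos : ∀ x ∈ l, 0 < x) : nonzeroExponents (exponentsOn S l) = l := by
  rw [nonzeroExponents, support_exponentsOn hl hpos]
  exact map_exponents S.nodup_toList (by simp [hl])

/-- Both directions use the same enumeration of the support, so a monomial amounts to a pair of a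
support and a list of positive exponents. -/
theorem exponentsOn_nonzeroExponents (a : Fin h →₀ ℕ) :
    exponentsOn a.support (nonzeroExponents a) = a := by
  have hl := length_nonzeroExponents a
  have h1 := nonzeroExponents_exponentsOn hl pos_of_mem_nonzeroExponents
  have h2 := support_exponentsOn hl pos_of_mem_nonzeroExponents
  ext v
  by_cases hv : v ∈ a.support
  · rw [nonzeroExponents, h2, nonzeroExponents] at h1
    exact List.map_inj_left.1 h1 v (Finset.mem_toList.2 hv)
  · rw [Finsupp.notMem_support_iff.1 hv]
    rw [← h2] at hv
    exact Finsupp.notMem_support_iff.1 hv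

theorem Sq_monomial (k : ℕ) (a : Fin h →₀ ℕ) :
    Sq h k (monomial a 1) = ((sqTerms k (nonzeroExponents a)).map fun t =>
      monomial (exponentsOn a.support t) (1 : ZMod 2)).sum := by
  conv_lhs => rw [← exponentsOn_nonzeroExponents a]
  exact Sq_exponents k (by simp [length_nonzeroExponents])

/-! ### Weight vectors -/

theorem weightVector_eq_zero {a : Fin h →₀ ℕ} (ha : ∑ j, a j = 10) {i : ℕ} (hi : 4 ≤ i) :
    ofLex (weightVector a) i = 0 := by
  refine Finset.sum_eq_zero (fun j _ => ?_ : ∀ j ∈ Finset.univ, a j / 2 ^ i % 2 = 0)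
  have h1 : a j ≤ 10 := ha ▸ Finset.single_le_sum (f := fun j => a j) (fun _ _ => Nat.zero_le _)
    (Finset.mem_univ j)
  have h2 : 2 ^ 4 ≤ 2 ^ i := Nat.pow_le_pow_right (by norm_num) hi
  rw [Nat.div_eq_of_lt (by omega)]

theorem weightVector_lt_hundred {a : Fin h →₀ ℕ} (ha : ∑ j, a j = 10) (i : ℕ) :
    ofLex (weightVector a) i < 100 := by
  have : ofLex (weightVector a) i ≤ ∑ j, a j :=
    show ∑ j, a j / 2 ^ i % 2 ≤ ∑ j, a j from Finset.sum_le_sum fun j _ => (Nat.mod_le _ _).trans (Nat.div_le_self _ _)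
  omega

/-- The vanishing of `w` from index 4 on forces the first difference into the coded entries; the
bound on `u` prevents its later digits from outweighing that difference. -/
theorem weightCode_lt {u w : ℕ → ℕ} (hu : ∀ i, u i < 100) (hw : ∀ i, 4 ≤ i → w i = 0)
    (h : toLex u < toLex w) : weightCode u < weightCode w := by
  obtain ⟨i, h1, h2⟩ := h
  have h1 : ∀ j < i, u j = w j := h1
  have h2 : u i < w i := h2
  have hi : i < 4 := by
    by_contra hi
    rw [hw i (by omega)] at h2
    omega
  have a1 := hu 1
  have a2 := hu 2
  have a3 := hu 3
  rw [weightCode, weightCode]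
  interval_cases i
  · omega
  · have := h1 0 (by omega)
    omega
  · have := h1 0 (by omega)
    have := h1 1 (by omega)
    omega
  · have := h1 0 (by omega)
    have := h1 1 (by omega)
    have := h1 2 (by omega)
    omega

theorem weightCode_le_iff {u w : ℕ → ℕ} (hu : ∀ i, u i < 100) (hu4 : ∀ i, 4 ≤ i → u i = 0)
    (hw : ∀ i, w i < 100) (hw4 : ∀ i, 4 ≤ i → w i = 0) :
    weightCode u ≤ weightCode w ↔ toLex u ≤ toLex w := by
  constructor
  · intro h
    by_contra hn
    exact absurd (weightCode_lt hw hu4 (not_le.1 hn)) (by omega)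
  · intro h
    rcases h.lt_or_eq with h | h
    · exact (weightCode_lt hu hw4 h).le
    · rw [toLex_inj.1 h]

/-! ### The coefficients of the normal form -/

/-- The coefficient, in the normal form, of the monomial with index `i` in the variables of `S`. -/
def normalCoeff (S : Finset (Fin h)) (i : ℕ) : P h →ₗ[ZMod 2] ZMod 2 :=
  (basisMonomials (Fin h) (ZMod 2)).constr (ZMod 2) fun a =>
    if a.support = S then bit (normalForm S.card (nonzeroExponents a)) i else 0

theorem normalCoeff_monomial (S : Finset (Fin h)) (i : ℕ) (a : Fin h →₀ ℕ) :
    normalCoeff S i (monomial a 1) =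
      if a.support = S then bit (normalForm S.card (nonzeroExponents a)) i else 0 := by
  have := (basisMonomials (Fin h) (ZMod 2)).constr_basis (ZMod 2) (fun a =>
    if a.support = S then bit (normalForm S.card (nonzeroExponents a)) i else 0) a
  rwa [coe_basisMonomials] at this

theorem normalCoeff_exponentsOn (S T : Finset (Fin h)) (i : ℕ) {l : List ℕ}
    (hl : l.length = T.card) (hpos : ∀ x ∈ l, 0 < x) :
    normalCoeff S i (monomial (exponentsOn T l) 1) =
      if T = S then bit (normalForm S.card l) i else 0 := by
  rw [normalCoeff_monomial, support_exponentsOn hl hpos, nonzeroExponents_exponentsOn hl hpos]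

/-- It suffices to test monomials. All terms of the square share the support of the monomial: if
this is not `S` each contributes zero, and otherwise the sum is the normal form of a hit vector. -/
theorem normalCoeff_Sq (S : Finset (Fin h)) (i : ℕ) {k : ℕ} (hk : 1 ≤ k) (f : P h) :
    normalCoeff S i (Sq h k f) = 0 := by
  have : (normalCoeff S i).comp (Sq h k) = 0 := by
    refine (basisMonomials (Fin h) (ZMod 2)).ext fun a => ?_
    rw [coe_basisMonomials, LinearMap.comp_apply, Sq_monomial, map_list_sum, List.map_map]
    have : ∀ t ∈ sqTerms k (nonzeroExponents a),
        (normalCoeff S i ∘ fun t => monomial (exponentsOn a.support t) (1 : ZMod 2)) t =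
          if a.support = S then bit (normalForm S.card t) i else 0 := fun t ht => by
      have h1 := mem_sqTerms ht
      exact normalCoeff_exponentsOn S _ i (h1.1.trans (length_nonzeroExponents a))
        (h1.2.1 pos_of_mem_nonzeroExponents)
    rw [List.map_congr_left this]
    split_ifs with hS
    · rw [← hS, ← length_nonzeroExponents,
        sum_bit_normalForm_sqTerms hk pos_of_mem_nonzeroExponents]
      rfl
    · simp
  exact LinearMap.congr_fun this f

theorem normalCoeff_of_mem_hits (S : Finset (Fin h)) (i : ℕ) {M : Submodule (ZMod 2) (P h)}
    {f : P h} (hf : f ∈ hits M) : normalCoeff S i f = 0 := by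
  have key : ∀ θ ∈ positiveSteenrod h, ∀ g, normalCoeff S i (θ g) = 0 := fun θ hθ => by
    induction hθ using NonUnitalAlgebra.adjoin_induction with
    | mem θ hθ =>
      obtain ⟨k, hk, rfl⟩ := hθ
      exact normalCoeff_Sq S i hk
    | zero => simp
    | add θ η _ _ h1 h2 => intro g; rw [LinearMap.add_apply, map_add, h1, h2, add_zero]
    -- In a product only the outermost operation matters.
    | mul θ η _ _ h1 _ => intro g; exact h1 (η g)
    | smul r θ _ h1 => intro g; rw [LinearMap.smul_apply, map_smul, h1, smul_zero]
  have : hits M ≤ LinearMap.ker (normalCoeff S i) := by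
    refine Submodule.span_le.2 ?_
    rintro _ ⟨θ, hθ, g, -, rfl⟩
    exact key θ hθ g
  exact this hf

/-! ### Monomials are congruent to their normal forms -/

/-- The sum of the monomials in the variables of `S` given by the bit vector `x`. -/
def expand (S : Finset (Fin h)) (x : ℕ) : P h :=
  ∑ j ∈ Finset.range (sortedCompositions S.card).length,
    bit x j • monomial (exponentsOn S ((sortedCompositions S.card).getD j [])) 1

theorem expand_zero (S : Finset (Fin h)) : expand S 0 = 0 := by simp [expand, bit_zero]

theorem expand_xor (S : Finset (Fin h)) (x y : ℕ) :
    expand S (x ^^^ y) = expand S x + expand S y := by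
  simp only [expand, bit_xor, add_smul, Finset.sum_add_distrib]

theorem expand_mask (S : Finset (Fin h)) {t : List ℕ} (ht : t ∈ sortedCompositions S.card) :
    expand S (mask (sortedCompositions S.card) t) = monomial (exponentsOn S t) 1 := by
  obtain ⟨j, hj, h1, h2⟩ := exists_mask_eq ht
  rw [expand, h1, Finset.sum_eq_single_of_mem j (Finset.mem_range.2 hj), h2, bit_two_pow,
    if_pos rfl, one_smul]
  intro i _ hi
  rw [bit_two_pow, if_neg hi.symm, zero_smul]

theorem expand_sumMask (S : Finset (Fin h)) {T : List (List ℕ)}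
    (hT : ∀ t ∈ T, t ∈ sortedCompositions S.card) :
    expand S (sumMask (sortedCompositions S.card) T) =
      (T.map fun t => monomial (exponentsOn S t) (1 : ZMod 2)).sum := by
  induction T with
  | nil => exact expand_zero S
  | cons t T ih =>
    simp only [List.mem_cons, forall_eq_or_imp] at hT
    have := ih hT.2
    rw [sumMask] at this ⊢
    rw [List.foldr_cons, expand_xor, this, expand_mask S hT.1, List.map_cons, List.sum_cons]

theorem monomial_mem_PZero {a : Fin h →₀ ℕ} :
    (monomial a 1 : P h) ∈ PZero h ↔ a.support ≠ Finset.univ := by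
  rw [PZero, monomial_mem_restrictSupport, or_iff_left one_ne_zero, Set.mem_ofPred_eq,
    Finset.prod_eq_zero_iff, Ne, Finset.eq_univ_iff_forall]
  simp

theorem Sq_mem_hits {M : Submodule (ZMod 2) (P h)} {k : ℕ} (hk : 1 ≤ k) {f : P h} (hf : f ∈ M) :
    Sq h k f ∈ hits M :=
  Submodule.subset_span ⟨_, NonUnitalAlgebra.subset_adjoin _ ⟨k, hk, rfl⟩, f, hf, rfl⟩

theorem monomial_add_expand_mem_hits {S : Finset (Fin h)} (hS : S ≠ Finset.univ) {l : List ℕ}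
    (hl : l ∈ sortedCompositions S.card) :
    monomial (exponentsOn S l) 1 + expand S (normalForm S.card l) ∈ hits (PZero h) := by
  have hadd : ∀ x y, expand S x ∈ hits (PZero h) → expand S y ∈ hits (PZero h) →
      expand S (x ^^^ y) ∈ hits (PZero h) := fun x y hx hy => by
    rw [expand_xor]
    exact add_mem hx hy
  have hzero : expand S 0 ∈ hits (PZero h) := by
    rw [expand_zero]
    exact zero_mem _
  have hgen : ∀ g ∈ hitMasks (sortedCompositions S.card) S.card,
      expand S g ∈ hits (PZero h) := fun g hg => by
    simp only [hitMasks, List.mem_flatMap, List.mem_range, List.mem_map] at hg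
    obtain ⟨k, hk, m, hm, rfl⟩ := hg
    obtain ⟨h1, h2, h3⟩ := mem_compositions.1 hm
    rw [expand_sumMask]
    · have := Sq_monomial (k + 1) (exponentsOn S m)
      rw [nonzeroExponents_exponentsOn h1 h2, support_exponentsOn h1 h2] at this
      rw [← this]
      refine Sq_mem_hits (by omega) (monomial_mem_PZero.2 ?_)
      rwa [support_exponentsOn h1 h2]
    -- Every term of the square must be listed, since `mask` would silently drop an unlisted one.
    · intro t ht
      obtain ⟨h4, h5, h6⟩ := mem_sqTerms ht
      exact mem_sortedCompositions.2 (mem_compositions.2 ⟨h4.trans h1, h5 h2, by omega⟩)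
  have := reduce_xor_self_mem (W := fun x => expand S x ∈ hits (PZero h)) hzero hadd
    (echelon_mem (W := fun x => expand S x ∈ hits (PZero h)) hzero hadd hgen)
    (mask (sortedCompositions S.card) l)
  rwa [expand_xor, expand_mask S hl] at this

/-! ### Dimensions -/

/-- The functionals `φ` identify the quotient with `ι → K`: they kill `U`, are dual to `b`, and `b`
spans modulo `U`. -/
theorem finrank_quotient_eq_card {K V ι : Type*} [Field K] [AddCommGroup V] [Module K V]
    [Fintype ι] [DecidableEq ι] {A U : Submodule K V} (φ : ι → V →ₗ[K] K) (b : ι → V)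
    (hb : ∀ i, b i ∈ A) (hφb : ∀ i j, φ i (b j) = if j = i then 1 else 0)
    (hφU : ∀ i, ∀ u ∈ U, φ i u = 0) (hA : A ≤ Submodule.span K (Set.range b) ⊔ U) :
    Module.finrank K (A ⧸ U.comap A.subtype) = Fintype.card ι := by
  let Φ : A →ₗ[K] (ι → K) := (LinearMap.pi φ).comp A.subtype
  have hΦ : U.comap A.subtype ≤ LinearMap.ker Φ := fun x hx => by
    ext i
    exact hφU i _ hx
  have hsum : ∀ (c : ι → K) (i : ι), φ i (∑ j, c j • b j) = c i := fun c i => by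
    simp [hφb]
  have hbij : Function.Bijective ((U.comap A.subtype).liftQ Φ hΦ) := by
    constructor
    · rw [← LinearMap.ker_eq_bot, Submodule.ker_liftQ_eq_bot']
      refine le_antisymm hΦ fun x hx => ?_
      obtain ⟨y, hy, u, hu, hyu⟩ := Submodule.mem_sup.1 (hA x.2)
      obtain ⟨c, rfl⟩ := (Submodule.mem_span_range_iff_exists_fun K).1 hy
      have hc : ∀ i, c i = 0 := fun i => by
        have h1 : φ i x = 0 := congrFun hx i
        rwa [← hyu, map_add, hsum, hφU i u hu, add_zero] at h1
      rw [Submodule.mem_comap, Submodule.subtype_apply, ← hyu]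
      simpa [hc] using hu
    · intro c
      refine ⟨Submodule.Quotient.mk ⟨∑ j, c j • b j,
        Submodule.sum_mem _ fun j _ => Submodule.smul_mem _ _ (hb j)⟩, ?_⟩
      ext i
      exact hsum c i
  rw [(LinearEquiv.ofBijective _ hbij).finrank_eq, Module.finrank_fintype_fun_eq_card]

theorem getD_mem_sortedCompositions {s j : ℕ} (hj : j < (sortedCompositions s).length) :
    (sortedCompositions s).getD j [] ∈ sortedCompositions s := by
  rw [List.getD_eq_getElem _ _ hj]
  exact List.getElem_mem hj

theorem finrank_QPZero {u : ℕ → ℕ} (hu : ∀ i, u i < 100) (hu4 : ∀ i, 4 ≤ i → u i = 0) :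
    Module.finrank (ZMod 2) (QPZero h 10 (toLex u)) =
      ∑ s ∈ Finset.range h, h.choose s * (normalIndices s (weightCode u)).card := by
  classical
  have hcode : ∀ a : Fin h →₀ ℕ,
      weightCode (listWeight (nonzeroExponents a)) = weightCode (ofLex (weightVector a)) :=
    fun a => congrArg weightCode (funext (listWeight_nonzeroExponents a))
  have hle : ∀ a : Fin h →₀ ℕ, ∑ j, a j = 10 →
      (weightCode (listWeight (nonzeroExponents a)) ≤ weightCode u ↔
        weightVector a ≤ toLex u) := fun a ha => by
    rw [hcode, weightCode_le_iff (weightVector_lt_hundred ha) (fun i => weightVector_eq_zero ha)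
      hu hu4, toLex_ofLex]
  have hsorted : ∀ (S : Finset (Fin h)) (l : List ℕ), l ∈ sortedCompositions S.card →
      l.length = S.card ∧ (∀ x ∈ l, 0 < x) ∧ (exponentsOn S l).support = S ∧
        nonzeroExponents (exponentsOn S l) = l ∧ ∑ j, exponentsOn S l j = 10 := fun S l hl => by
    obtain ⟨h1, h2, -⟩ := mem_compositions.1 (mem_sortedCompositions.1 hl)
    refine ⟨h1, h2, support_exponentsOn h1 h2, nonzeroExponents_exponentsOn h1 h2, ?_⟩
    rw [← nonzeroExponents_mem_sortedCompositions, support_exponentsOn h1 h2,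
      nonzeroExponents_exponentsOn h1 h2]
    exact hl
  have hmem : ∀ (S : Finset (Fin h)) (l : List ℕ), S ≠ Finset.univ →
      l ∈ sortedCompositions S.card → weightCode (listWeight l) ≤ weightCode u →
      monomial (exponentsOn S l) 1 ∈ PZero h ⊓ weightLE h 10 (toLex u) := fun S l hS hl hw => by
    obtain ⟨-, -, h3, h4, h5⟩ := hsorted S l hl
    refine ⟨monomial_mem_PZero.2 (by rwa [h3]), (monomial_mem_restrictSupport _).2 (Or.inl ⟨h5, ?_⟩)⟩
    rwa [← hle _ h5, h4]
  let ι := (S : {S : Finset (Fin h) // S ≠ Finset.univ}) ×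
    normalIndices S.1.card (weightCode u)
  let b : ι → P h := fun i =>
    monomial (exponentsOn i.1.1 ((sortedCompositions i.1.1.card).getD i.2.1 [])) 1
  have hι : ∀ i : ι, (sortedCompositions i.1.1.card).getD i.2.1 [] ∈
      sortedCompositions i.1.1.card ∧
      weightCode (listWeight ((sortedCompositions i.1.1.card).getD i.2.1 [])) = weightCode u ∧
      normalForm i.1.1.card ((sortedCompositions i.1.1.card).getD i.2.1 []) = 2 ^ i.2.1 :=
    fun i => by
      have := Finset.mem_filter.1 i.2.2
      exact ⟨getD_mem_sortedCompositions (Finset.mem_range.1 this.1), this.2⟩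
  have hcard : Fintype.card ι =
      ∑ s ∈ Finset.range h, h.choose s * (normalIndices s (weightCode u)).card := by
    rw [Fintype.card_sigma]
    simp only [Fintype.card_coe]
    -- Subsets are counted by size, and the term of the full set is cancelled from both sides.
    have h1 := Finset.sum_powerset_apply_card
      (fun s => (normalIndices s (weightCode u)).card) (x := (Finset.univ : Finset (Fin h)))
    rw [Finset.powerset_univ, Finset.card_fin, Finset.sum_range_succ, Nat.choose_self, one_smul,
      ← Finset.sum_erase_add _ _ (Finset.mem_univ (Finset.univ : Finset (Fin h))),
      Finset.card_fin, add_left_inj] at h1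
    simp only [smul_eq_mul] at h1
    rw [← h1]
    exact (Finset.sum_subtype _ (by simp)
      (fun S : Finset (Fin h) => (normalIndices S.card (weightCode u)).card)).symm
  rw [← hcard]
  refine finrank_quotient_eq_card (fun i => normalCoeff i.1.1 i.2.1) b
    (fun i => hmem _ _ i.1.2 (hι i).1 (hι i).2.1.le) ?_ ?_ ?_
  · rintro ⟨S, i, hi⟩ ⟨T, j, hj⟩
    obtain ⟨h1, -, h3⟩ := hι ⟨T, j, hj⟩
    obtain ⟨h4, h5, -⟩ := hsorted _ _ h1
    rw [normalCoeff_exponentsOn _ _ _ h4 h5]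
    by_cases hST : T = S
    · subst hST
      rw [if_pos rfl, h3, bit_two_pow]
      exact if_congr ⟨fun e => by subst e; rfl, congrArg fun i : ι => i.2.1⟩ rfl rfl
    · rw [if_neg fun e => hST (Subtype.ext e), if_neg fun e => hST (congrArg Sigma.fst e)]
  · intro i f hf
    obtain ⟨f₁, hf₁, f₂, hf₂, rfl⟩ := Submodule.mem_sup.1 hf
    rw [map_add, normalCoeff_of_mem_hits _ _ hf₁.1, zero_add]
    -- A monomial of weight below `ω` has a normal form of weights below `ω`, so its coefficient at
    -- a monomial of weight exactly `ω` is zero.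
    have hlt : weightLT h 10 (toLex u) ≤ LinearMap.ker (normalCoeff i.1.1 i.2.1) := by
      rw [weightLT, restrictSupport_eq_span, Submodule.span_le]
      rintro _ ⟨a, ⟨ha, hau⟩, rfl⟩
      rw [SetLike.mem_coe, LinearMap.mem_ker, normalCoeff_monomial]
      split_ifs with hS
      · rw [bit, if_neg]
        intro hbit
        have hl := nonzeroExponents_mem_sortedCompositions.2 ha
        rw [hS] at hl
        have hi := Finset.mem_range.1 (Finset.mem_filter.1 i.2.2).1
        have h1 := (normalForm_testBit hl hi hbit).1
        rw [(hι i).2.1, hcode] at h1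
        exact absurd (weightCode_lt (weightVector_lt_hundred ha) hu4 hau) (by omega)
      · rfl
    exact hlt hf₂.2
  · have hLT : ∀ a : Fin h →₀ ℕ, a.support ≠ Finset.univ → ∑ j, a j = 10 →
        weightVector a < toLex u →
        monomial a 1 ∈ Submodule.span (ZMod 2) (Set.range b) ⊔ omegaHits (PZero h) 10 (toLex u) :=
      fun a hS ha hau => Submodule.mem_sup_right (Submodule.mem_sup_right
        ⟨monomial_mem_PZero.2 hS, (monomial_mem_restrictSupport _).2 (Or.inl ⟨ha, hau⟩)⟩)
    have hV : PZero h ⊓ weightLE h 10 (toLex u) ≤ Submodule.span (ZMod 2)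
        ((fun a => monomial a (1 : ZMod 2)) '' {a : Fin h →₀ ℕ | a.support ≠ Finset.univ ∧
          ∑ j, a j = 10 ∧ weightVector a ≤ toLex u}) := by
      rintro f ⟨hf₁, hf₂⟩
      rw [← restrictSupport_eq_span, mem_restrictSupport_iff]
      intro a ha
      refine ⟨?_, hf₂ ha⟩
      have := hf₁ ha
      rwa [← monomial_mem_PZero, PZero, monomial_mem_restrictSupport, or_iff_left one_ne_zero]
    refine hV.trans (Submodule.span_le.2 ?_)
    rintro _ ⟨a, ⟨hS, ha, hau⟩, rfl⟩
    rcases hau.lt_or_eq with hlt | heq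
    · exact hLT a hS ha hlt
    have hl := nonzeroExponents_mem_sortedCompositions.2 ha
    have hhit := monomial_add_expand_mem_hits hS hl
    have hw : weightCode (listWeight (nonzeroExponents a)) ≤ weightCode u := (hle a ha).2 hau
    have hmon := hmem _ _ hS hl hw
    -- The first membership is needed because a hit element counts in `omegaHits` only if it lies in
    -- `P⁰_n(ω)` itself.
    have hexp : expand a.support (normalForm a.support.card (nonzeroExponents a)) ∈
        (PZero h ⊓ weightLE h 10 (toLex u)) ⊓
          (Submodule.span (ZMod 2) (Set.range b) ⊔ omegaHits (PZero h) 10 (toLex u)) := by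
      refine Submodule.sum_mem _ fun j hj => ?_
      have hj := Finset.mem_range.1 hj
      rw [bit]
      split_ifs with hbit
      · rw [one_smul]
        obtain ⟨h1, h2⟩ := normalForm_testBit hl hj hbit
        have hjM := getD_mem_sortedCompositions hj
        refine ⟨hmem _ _ hS hjM (h1.trans hw), ?_⟩
        obtain ⟨-, -, h3, h4, h5⟩ := hsorted _ _ hjM
        -- A term of the normal form either has weight `ω`, and is then one of the `b`, or has
        -- smaller weight and vanishes in the quotient.
        by_cases hc : weightCode u ≤
            weightCode (listWeight ((sortedCompositions a.support.card).getD j []))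
        · refine Submodule.mem_sup_left (Submodule.subset_span ⟨⟨⟨a.support, hS⟩, j, ?_⟩, rfl⟩)
          rw [normalIndices, Finset.mem_filter, Finset.mem_range]
          exact ⟨hj, le_antisymm (h1.trans hw) hc, h2⟩
        · refine hLT _ (by rwa [h3]) h5 (lt_of_le_of_ne ?_ fun e => hc ?_)
          · rw [← hle _ h5, h4]
            exact h1.trans hw
          · rw [← h4, hcode, e, ofLex_toLex]
      · rw [zero_smul]
        exact zero_mem _
    have hmon' : (monomial a 1 : P h) =
        (monomial (exponentsOn a.support (nonzeroExponents a)) 1 +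
          expand a.support (normalForm a.support.card (nonzeroExponents a))) -
          expand a.support (normalForm a.support.card (nonzeroExponents a)) := by
      rw [add_sub_cancel_right, exponentsOn_nonzeroExponents]
    change (monomial a 1 : P h) ∈ _
    rw [hmon']
    exact sub_mem (Submodule.mem_sup_right (Submodule.mem_sup_left
      ⟨hhit, add_mem hmon hexp.1⟩)) hexp.2

/-! ### Evaluation of the dimension sum -/

theorem finrank_QPZero_ofList {l : List ℕ} (hl : l.length ≤ 4) (hl' : ∀ x ∈ l, x < 100) :
    Module.finrank (ZMod 2) (QPZero h 10 (ofList l)) =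
      ∑ s ∈ Finset.range h, h.choose s *
        (normalIndices s (weightCode fun i => l.getD i 0)).card := by
  refine finrank_QPZero (fun i => ?_) fun i hi => List.getD_eq_default _ _ (by omega)
  rcases lt_or_ge i l.length with hi | hi
  · rw [List.getD_eq_getElem _ _ hi]
    exact hl' _ (List.getElem_mem hi)
  · rw [List.getD_eq_default _ _ hi]
    norm_num

/-- The counts vanish for nine or more variables, so truncating at `m ≥ 7` leaves only `s = 7` and
`s = 8` to be examined. -/
theorem getD_normalCounts_eq_zero {s i m : ℕ} (hs : m ≤ s)
    (h7 : m ≤ 7 → (normalCounts 7).getD i 0 = 0) (h8 : m ≤ 8 → (normalCounts 8).getD i 0 = 0)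
    (hm : 7 ≤ m) : (normalCounts s).getD i 0 = 0 := by
  match s with
  | 0 | 1 | 2 | 3 | 4 | 5 | 6 => omega
  | 7 => exact h7 hs
  | 8 => exact h8 hs
  | s + 9 =>
    have : normalCounts (s + 9) = List.replicate 5 0 := rfl
    rw [this, List.getD_eq_getElem?_getD, List.getElem?_replicate]
    split_ifs <;> rfl

/-- The dimension formula with the contributions of all numbers of variables. -/
theorem finrank_QPZero_ofList_eq {l : List ℕ} (hl : l.length ≤ 4) (hl' : ∀ x ∈ l, x < 100)
    {i : ℕ} (hi : [2020100, 2040000, 4010100, 4030000, 6020000][i]? =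
      some (weightCode fun i => l.getD i 0)) {m : ℕ} (hm : 7 ≤ m) (hmh : m ≤ h)
    (h7 : m ≤ 7 → m < h → (normalCounts 7).getD i 0 = 0)
    (h8 : m ≤ 8 → m < h → (normalCounts 8).getD i 0 = 0) :
    Module.finrank (ZMod 2) (QPZero h 10 (ofList l)) =
      ∑ s ∈ Finset.range m, h.choose s * (normalCounts s).getD i 0 := by
  have hcard : ∀ s, (normalIndices s (weightCode fun i => l.getD i 0)).card =
      (normalCounts s).getD i 0 := fun s => by
    rw [← card_normalIndices, List.getD_eq_getElem?_getD, List.getElem?_map, hi]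
    rfl
  rw [finrank_QPZero_ofList hl hl']
  simp only [hcard]
  symm
  -- The terms with `m ≤ s < h` vanish; there are none when `m = h`, which is why `h7` and `h8`
  -- assume `m < h`.
  refine Finset.sum_subset (Finset.range_mono hmh) fun s hs hsm => ?_
  have hsh := Finset.mem_range.1 hs
  have hms : m ≤ s := by simpa using hsm
  rw [getD_normalCounts_eq_zero hms (fun h => h7 h (by omega)) (fun h => h8 h (by omega)) hm,
    mul_zero]

end HitProblem

end

theorem mainTheorem9 (h : ℕ) (hh : 7 ≤ h) :
    Module.finrank (ZMod 2) (HitProblem.QPZero h 10 (HitProblem.ofList [2, 2, 1])) =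
      2 * (h.choose 2 + 4 * h.choose 3 + 6 * h.choose 4) + 5 * h.choose 5 ∧
    Module.finrank (ZMod 2) (HitProblem.QPZero h 10 (HitProblem.ofList [2, 4])) =
      5 * h.choose 5 + 4 * h.choose 6 ∧
    Module.finrank (ZMod 2) (HitProblem.QPZero h 10 (HitProblem.ofList [4, 1, 1])) =
      10 * (h.choose 4 + 2 * h.choose 5 + h.choose 6) ∧
    (h = 7 →
      Module.finrank (ZMod 2) (HitProblem.QPZero h 10 (HitProblem.ofList [4, 3])) = 812) ∧
    (8 ≤ h →
      Module.finrank (ZMod 2) (HitProblem.QPZero h 10 (HitProblem.ofList [4, 3])) =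
        4 * (h.choose 4 + 5 * h.choose 5 + 9 * h.choose 6 + 5 * h.choose 7)) ∧
    (h = 7 →
      Module.finrank (ZMod 2) (HitProblem.QPZero h 10 (HitProblem.ofList [6, 2])) = 105) ∧
    (h = 8 →
      Module.finrank (ZMod 2) (HitProblem.QPZero h 10 (HitProblem.ofList [6, 2])) = 700) ∧
    (9 ≤ h →
      Module.finrank (ZMod 2) (HitProblem.QPZero h 10 (HitProblem.ofList [6, 2])) =
        5 * (3 * h.choose 6 + 7 * h.choose 7 + 4 * h.choose 8)) := by
  open HitProblem in
  refine ⟨?_, ?_, ?_, ?_, ?_, ?_, ?_, ?_⟩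
  · rw [finrank_QPZero_ofList_eq (i := 0) (m := 7) (by decide) (by decide) rfl le_rfl hh
      (fun _ _ => rfl) (fun _ _ => rfl)]
    simp [Finset.sum_range_succ, normalCounts]
    ring
  · rw [finrank_QPZero_ofList_eq (i := 1) (m := 7) (by decide) (by decide) rfl le_rfl hh
      (fun _ _ => rfl) (fun _ _ => rfl)]
    simp [Finset.sum_range_succ, normalCounts]
    ring
  · rw [finrank_QPZero_ofList_eq (i := 2) (m := 7) (by decide) (by decide) rfl le_rfl hh
      (fun _ _ => rfl) (fun _ _ => rfl)]
    simp [Finset.sum_range_succ, normalCounts]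
    ring
  · rintro rfl
    -- For `h = 7` the sum stops at `s = 6`: monomials in all seven variables are not in `P⁰`, so
    -- the nonzero count for `s = 7` does not enter.
    rw [finrank_QPZero_ofList_eq (i := 3) (m := 7) (by decide) (by decide) rfl le_rfl le_rfl
      (by omega) (by omega)]
    decide
  · intro h8
    rw [finrank_QPZero_ofList_eq (i := 3) (m := 8) (by decide) (by decide) rfl (by omega) h8
      (by omega) (fun _ _ => rfl)]
    simp [Finset.sum_range_succ, normalCounts]
    ring
  · rintro rfl
    rw [finrank_QPZero_ofList_eq (i := 4) (m := 7) (by decide) (by decide) rfl le_rfl le_rfl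
      (by omega) (by omega)]
    decide
  · rintro rfl
    -- For `h = 8` the count 20 for `s = 8` is likewise excluded; it enters only from `h = 9` on.
    rw [finrank_QPZero_ofList_eq (i := 4) (m := 8) (by decide) (by decide) rfl (by omega) le_rfl
      (by omega) (by omega)]
    decide
  · intro h9
    rw [finrank_QPZero_ofList_eq (i := 4) (m := 9) (by decide) (by decide) rfl (by omega) h9
      (by omega) (by omega)]
    simp [Finset.sum_range_succ, normalCounts]
    ring
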